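/- Let $(\Omega,\Sigma)$ be a standard Borel space. A game is a function $\nu:\Sigma\to\mathbb R$ with $\nu(\emptyset)=0$; it is monotone if $S\subseteq T$ implies $\nu(S)\le\nu(T)$, and $\mu\preceq\nu$ means that $\nu-\mu$ is monotone. Let $BV$ be the space of differences of two monotone games, $NA$ the space of nonatomic countably additive real-valued signed measures on $\Sigma$, ordered setwise, $NA^+$ its cone of nonnegative elements, and $NA^1$ the set of probability measures in $NA$. Let $AC_\infty$ be the space of games $\nu\in BV$ such that $-\mu\preceq\nu\preceq\mu$ for some $\mu\in NA^+$, normed by $\|\nu\|_\infty=\inf\{\mu(\Omega):\mu\in NA^+,\ -\mu\preceq\nu\preceq\mu\}$; it contains $NA$. For $\lambda\in NA^+$, a game $\nu$ is $\delta_\lambda$-Burkill–Cesari integrable if for every $E\in\Sigma$ the sums $\sum_{I\in D}\nu(I)$ over finite measurable partitions $D$ of $E$ converge to a real number $\partial^+_\emptyset(\nu,E)$ as $\max_{I\in D}\lambda(I)\to0$; $BC$ is the space of games which are $\delta_\lambda$-Burkill–Cesari integrable for some $\lambda\in NA^+$. Put $Q=BC\cap AC_\infty$, and let $Y$ be the $\|\cdot\|_\infty$-closure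 of $Q$ in $AC_\infty$. Let $pNA_\infty$ be the $\|\cdot\|_\infty$-closure in $AC_\infty$ of the linear span of the powers $\mu^k$ with $\mu\in NA^1$ and $k\ge1$ an integer. For $\nu\in AC_\infty$ let $\nu_*$ be the least upper bound in $NA$ of $\{\lambda\in NA:\lambda\preceq\nu\}$ and $\nu^*$ the greatest lower bound in $NA$ of $\{\lambda\in NA:\nu\preceq\lambda\}$. A linear map $\psi:W\to NA$ on a linear space $NA\subseteq W\subseteq AC_\infty$ is a Milnor operator if for every $\nu\in W$ both $\nu_*$ and $\nu^*$ exist and $\nu_*\le\psi\nu\le\nu^*$. An extended BC integral is a Milnor operator $\widetilde\partial:AC_\infty\to NA$ with $\widetilde\partial(\nu)=\partial^+_\emptyset(\nu,\cdot)$ for all $\nu\in Q$. For an automorphism $\vartheta$ of $(\Omega,\Sigma)$ put $(\vartheta_*\nu)(E)=\nu(\vartheta(E))$; a linear space of games is symmetric if it is invariant under all $\vartheta_*$. A semivalue on a symmetric linear subspace $V$ of $BV$ is a linear map $\varphi:V\to NA$ such that $\vartheta_*\varphi(\nu)=\varphi(\vartheta_*\nu)$ for all $\vartheta$ and all $\nu\in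 V$, $\varphi(\nu)\ge0$ for every monotone $\nu\in V$, and $\varphi(\nu)=\nu$ for every $\nu\in NA\cap V$. **Claim.** $pNA_\infty\subseteq Y$; an extended BC integral exists; and for every extended BC integral $\widetilde\partial$, the space $pNA_\infty$ is a symmetric subspace of $BV$ and the restriction of $\widetilde\partial$ to $pNA_\infty$ is a semivalue on $pNA_\infty$ which is continuous from $(pNA_\infty,\|\cdot\|_\infty)$ to $(NA,\|\cdot\|_\infty)$. -/

import Mathlib

open MeasureTheory Set

noncomputable section

namespace NonatomicGames

/-- The coalitions: the `σ`-algebra `Σ` of measurable subsets of `Ω`, with its Boolean algebra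
structure (`⊥ = ∅`, `⊤ = Ω`, `≤` is inclusion). -/
abbrev Coalition (Ω : Type*) [MeasurableSpace Ω] : Type _ :=
  Subtype (MeasurableSet : Set Ω → Prop)

/-- The linear space of set functions `ν : Σ → ℝ` with `ν(∅) = 0`. -/
def gameSubmodule (Ω : Type*) [MeasurableSpace Ω] : Submodule ℝ (Coalition Ω → ℝ) where
  carrier := {ν | ν ⊥ = 0}
  zero_mem' := rfl
  add_mem' := by
    intro a b ha hb
    simp only [mem_ofPred_eq, Pi.add_apply] at *
    rw [ha, hb, add_zero]
  smul_mem' := by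
    intro c a ha
    simp only [mem_ofPred_eq, Pi.smul_apply, smul_eq_mul] at *
    rw [ha, mul_zero]

/-- Transferable utility games on `(Ω, Σ)`. No topology is put on this space. -/
def Game (Ω : Type*) [MeasurableSpace Ω] : Type _ := gameSubmodule Ω

section Basic

variable {Ω : Type*} [MeasurableSpace Ω]

instance : AddCommGroup (Game Ω) := inferInstanceAs (AddCommGroup (gameSubmodule Ω))

instance : Module ℝ (Game Ω) := inferInstanceAs (Module ℝ (gameSubmodule Ω))

instance : CoeFun (Game Ω) (fun _ => Coalition Ω → ℝ) := ⟨fun ν => ν.1⟩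

/-- The setwise order: `ν ≤ ν'` iff `ν(S) ≤ ν'(S)` for every coalition `S`. -/
instance : PartialOrder (Game Ω) := PartialOrder.lift (fun ν : Game Ω => ν.1) Subtype.val_injective

theorem Game.le_def (μ ν : Game Ω) : μ ≤ ν ↔ ∀ S, μ S ≤ ν S := Iff.rfl

theorem Game.ext {μ ν : Game Ω} (h : ∀ S, μ S = ν S) : μ = ν := Subtype.ext (funext h)

@[simp] theorem Game.map_bot (ν : Game Ω) : ν ⊥ = 0 := ν.2

@[simp] theorem Game.zero_apply (S : Coalition Ω) : (0 : Game Ω) S = 0 := rfl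

@[simp] theorem Game.add_apply (μ ν : Game Ω) (S : Coalition Ω) : (μ + ν) S = μ S + ν S := rfl

@[simp] theorem Game.sub_apply (μ ν : Game Ω) (S : Coalition Ω) : (μ - ν) S = μ S - ν S := rfl

@[simp] theorem Game.neg_apply (ν : Game Ω) (S : Coalition Ω) : (-ν) S = -ν S := rfl

@[simp] theorem Game.smul_apply (c : ℝ) (ν : Game Ω) (S : Coalition Ω) : (c • ν) S = c * ν S := rfl

/-- A game is monotone if `S ⊆ T` implies `ν(S) ≤ ν(T)`. -/
def Game.IsMonotone (ν : Game Ω) : Prop := ∀ ⦃S T : Coalition Ω⦄, S ≤ T → ν S ≤ ν T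

/-- `μ ≼ ν`: the order induced by the cone of monotone games. -/
def Game.Prec (μ ν : Game Ω) : Prop := (ν - μ).IsMonotone

/-- The space `BV` of games of bounded variation, that is, of differences of two monotone games. -/
def BV (Ω : Type*) [MeasurableSpace Ω] : Submodule ℝ (Game Ω) where
  carrier := {ν | ∃ u v : Game Ω, u.IsMonotone ∧ v.IsMonotone ∧ ν = u - v}
  zero_mem' := ⟨0, 0, fun _ _ _ => le_rfl, fun _ _ _ => le_rfl, by simp⟩
  add_mem' := by
    rintro _ _ ⟨u, v, hu, hv, rfl⟩ ⟨u', v', hu', hv', rfl⟩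
    refine ⟨u + u', v + v', fun S T h => ?_, fun S T h => ?_, by abel⟩
    · exact add_le_add (hu h) (hu' h)
    · exact add_le_add (hv h) (hv' h)
  smul_mem' := by
    rintro c _ ⟨u, v, hu, hv, rfl⟩
    rcases le_total 0 c with hc | hc
    · exact ⟨c • u, c • v, fun S T h => mul_le_mul_of_nonneg_left (hu h) hc,
        fun S T h => mul_le_mul_of_nonneg_left (hv h) hc, smul_sub _ _ _⟩
    · exact ⟨(-c) • v, (-c) • u,
        fun S T h => mul_le_mul_of_nonneg_left (hv h) (by linarith),
        fun S T h => mul_le_mul_of_nonneg_left (hu h) (by linarith), by module⟩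

/-- A signed measure `s` is nonatomic if it has no atom: there is no measurable `A` with
`|s|(A) > 0` such that every measurable `B ⊆ A` has `|s|(B) = 0` or `|s|(A \ B) = 0`. -/
def IsNonatomic (s : SignedMeasure Ω) : Prop :=
  ¬ ∃ A : Set Ω, MeasurableSet A ∧ 0 < s.totalVariation A ∧
    ∀ B ⊆ A, MeasurableSet B → s.totalVariation B = 0 ∨ s.totalVariation (A \ B) = 0

theorem toJordan_apply (s : SignedMeasure Ω) {A : Set Ω} (hA : MeasurableSet A) :
    s A = s.toJordanDecomposition.posPart.real A - s.toJordanDecomposition.negPart.real A := by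
  conv_lhs => rw [← s.toSignedMeasure_toJordanDecomposition]
  simp [JordanDecomposition.toSignedMeasure, Measure.toSignedMeasure_apply_measurable hA]

theorem totalVariation_singleton [MeasurableSingletonClass Ω] {s : SignedMeasure Ω} {x : Ω}
    (h : s {x} = 0) : s.totalVariation {x} = 0 := by
  have hx := toJordan_apply s (measurableSet_singleton x)
  rw [h] at hx
  obtain ⟨u, hu, h1, h2⟩ := s.toJordanDecomposition.mutuallySingular
  rw [SignedMeasure.totalVariation, Measure.add_apply]
  have key : s.toJordanDecomposition.posPart {x} = 0 ∨ s.toJordanDecomposition.negPart {x} = 0 := by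
    by_cases hxu : x ∈ u
    · exact Or.inl (measure_mono_null (by simpa using hxu) h1)
    · exact Or.inr (measure_mono_null (by simpa using hxu) h2)
  have heq : s.toJordanDecomposition.posPart.real {x} =
      s.toJordanDecomposition.negPart.real {x} := by linarith
  rcases key with hk | hk
  · have : s.toJordanDecomposition.negPart.real {x} = 0 := by
      rw [← heq, measureReal_def, hk, ENNReal.toReal_zero]
    rw [hk, (measureReal_eq_zero_iff).1 this, add_zero]
  · have : s.toJordanDecomposition.posPart.real {x} = 0 := by
      rw [heq, measureReal_def, hk, ENNReal.toReal_zero]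
    rw [hk, (measureReal_eq_zero_iff).1 this, add_zero]

/-- On a standard Borel space a signed measure is nonatomic iff it charges no point. -/
theorem isNonatomic_iff [StandardBorelSpace Ω] (s : SignedMeasure Ω) :
    IsNonatomic s ↔ ∀ x, s {x} = 0 := by
  constructor
  · intro h x
    by_contra hx
    refine h ⟨{x}, measurableSet_singleton x, ?_, fun B hB _ => ?_⟩
    · exact pos_iff_ne_zero.2 (fun h0 => hx (s.null_of_totalVariation_zero h0))
    · rcases subset_singleton_iff_eq.1 hB with rfl | rfl
      · exact Or.inl measure_empty
      · exact Or.inr (by simp)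
  · rintro h ⟨A, hA, hpos, hat⟩
    have := Filter.exists_subset_subsingleton_mem_of_forall_separating
      (l := ae (s.totalVariation.restrict A)) (s := A) MeasurableSet (ae_restrict_mem hA)
      (fun U hU => by
        rw [mem_ae_iff, mem_ae_iff, compl_compl, Measure.restrict_apply hU.compl,
          Measure.restrict_apply hU]
        rcases hat (U ∩ A) inter_subset_right (hU.inter hA) with h0 | h0
        · exact Or.inr h0
        · refine Or.inl (measure_mono_null (fun y hy => ?_) h0)
          exact ⟨hy.2, fun hy' => hy.1 hy'.1⟩)
    obtain ⟨t, htA, ht, hmem⟩ := this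
    rw [mem_ae_iff, Measure.restrict_apply ht.measurableSet.compl] at hmem
    have h0 : s.totalVariation t = 0 := by
      rcases ht.eq_empty_or_singleton with rfl | ⟨x, rfl⟩
      · exact measure_empty
      · exact totalVariation_singleton (h x)
    refine hpos.ne' (measure_mono_null (fun y hy => ?_) (measure_union_null h0 hmem))
    by_cases hyt : y ∈ t
    · exact Or.inl hyt
    · exact Or.inr ⟨hyt, hy⟩

/-- The Burkill-Cesari integral of `ν` with respect to the mesh `δ_λ(D) = max {λ(I) : I ∈ D}`
exists on every coalition and equals `m`: for every `E`, the sums `∑_{I ∈ D} ν(I)` over finite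
measurable partitions `D` of `E` converge to `m(E)` as `δ_λ(D) → 0`. -/
def HasBCIntegral (lam ν : Game Ω) (m : Coalition Ω → ℝ) : Prop :=
  ∀ E : Coalition Ω, ∀ ε > 0, ∃ δ > 0, ∀ D : Finpartition E,
    (∀ I ∈ D.parts, lam I < δ) → |∑ I ∈ D.parts, ν I - m E| < ε

theorem HasBCIntegral.mono {lam lam' ν : Game Ω} {m : Coalition Ω → ℝ} (h : HasBCIntegral lam ν m)
    (hle : lam ≤ lam') : HasBCIntegral lam' ν m := by
  intro E ε hε
  obtain ⟨δ, hδ, H⟩ := h E ε hε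
  exact ⟨δ, hδ, fun D hD => H D fun I hI => (hle I).trans_lt (hD I hI)⟩

/-- The space `NA` of nonatomic countably additive (signed, real valued) measures, as games. -/
def NA (Ω : Type*) [MeasurableSpace Ω] [StandardBorelSpace Ω] : Submodule ℝ (Game Ω) where
  carrier := {ν | ∃ s : SignedMeasure Ω, IsNonatomic s ∧ ∀ S : Coalition Ω, ν S = s (S : Set Ω)}
  zero_mem' := ⟨0, (isNonatomic_iff _).2 (fun _ => rfl), fun _ => rfl⟩
  add_mem' := by
    rintro a b ⟨s, hs, ha⟩ ⟨t, ht, hb⟩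
    rw [isNonatomic_iff] at hs ht
    exact ⟨s + t, (isNonatomic_iff _).2 (fun x => by simp [hs x, ht x]),
      fun S => by simp [ha S, hb S]⟩
  smul_mem' := by
    rintro c a ⟨s, hs, ha⟩
    rw [isNonatomic_iff] at hs
    exact ⟨c • s, (isNonatomic_iff _).2 (fun x => by simp [hs x]), fun S => by simp [ha S]⟩

variable [StandardBorelSpace Ω]

variable (Ω) in
/-- The cone `NA⁺` of nonnegative elements of `NA`. -/
def NAPos : Set (Game Ω) := {μ | μ ∈ NA Ω ∧ 0 ≤ μ}

variable (Ω) in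
/-- The set `NA¹` of nonatomic probability measures. -/
def NAProb : Set (Game Ω) := {μ | μ ∈ NAPos Ω ∧ μ ⊤ = 1}

theorem NA_isMonotone {μ : Game Ω} (hμ : μ ∈ NAPos Ω) : μ.IsMonotone := by
  obtain ⟨⟨s, -, hs⟩, hpos⟩ := hμ
  intro S T hST
  have hST' : (S : Set Ω) ⊆ T := hST
  have h := VectorMeasure.of_add_of_sdiff (v := s) S.2 T.2 hST'
  have h2 : (0 : ℝ) ≤ μ ⟨(T : Set Ω) \ S, T.2.diff S.2⟩ := hpos _
  rw [hs] at h2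
  rw [hs, hs, ← h]
  exact le_add_of_nonneg_right h2

/-- `-μ ≼ ν ≼ μ` with `μ ∈ NA⁺`. -/
def Dominates (μ ν : Game Ω) : Prop := μ ∈ NAPos Ω ∧ Game.Prec (-μ) ν ∧ Game.Prec ν μ

theorem NAPos_add {μ ν : Game Ω} (hμ : μ ∈ NAPos Ω) (hν : ν ∈ NAPos Ω) : μ + ν ∈ NAPos Ω :=
  ⟨add_mem hμ.1 hν.1, fun S => add_nonneg (hμ.2 S) (hν.2 S)⟩

theorem NAPos_smul {c : ℝ} (hc : 0 ≤ c) {μ : Game Ω} (hμ : μ ∈ NAPos Ω) : c • μ ∈ NAPos Ω :=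
  ⟨(NA Ω).smul_mem c hμ.1, fun S => mul_nonneg hc (hμ.2 S)⟩

theorem dominates_iff {μ ν : Game Ω} :
    Dominates μ ν ↔ μ ∈ NAPos Ω ∧ ∀ S T : Coalition Ω, S ≤ T → |ν T - ν S| ≤ μ T - μ S := by
  refine and_congr_right fun _ => ⟨fun h S T hST => ?_, fun h => ⟨fun S T hST => ?_, fun S T hST => ?_⟩⟩
  · have h1 := h.1 hST
    have h2 := h.2 hST
    simp only [Game.sub_apply, Game.neg_apply] at h1 h2
    rw [abs_le]
    constructor <;> linarith
  · have := abs_le.1 (h S T hST)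
    simp only [Game.sub_apply, Game.neg_apply]
    linarith
  · have := abs_le.1 (h S T hST)
    simp only [Game.sub_apply]
    linarith

theorem Dominates.add {μ μ' ν ν' : Game Ω} (h : Dominates μ ν) (h' : Dominates μ' ν') :
    Dominates (μ + μ') (ν + ν') := by
  rw [dominates_iff] at *
  refine ⟨NAPos_add h.1 h'.1, fun S T hST => ?_⟩
  have h1 := abs_le.1 (h.2 S T hST)
  have h2 := abs_le.1 (h'.2 S T hST)
  simp only [Game.add_apply]
  rw [abs_le]
  constructor <;> linarith

theorem Dominates.smul {μ ν : Game Ω} (c : ℝ) (h : Dominates μ ν) :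
    Dominates (|c| • μ) (c • ν) := by
  rw [dominates_iff] at *
  refine ⟨NAPos_smul (abs_nonneg c) h.1, fun S T hST => ?_⟩
  simp only [Game.smul_apply]
  rw [← mul_sub, ← mul_sub, abs_mul]
  exact mul_le_mul_of_nonneg_left (h.2 S T hST) (abs_nonneg c)

variable (Ω) in
/-- The space `AC_∞` of Lipschitz games: games `ν` in `BV` for which there is `μ ∈ NA⁺` such that
both `μ - ν` and `ν + μ` are monotone. -/
def ACInf : Submodule ℝ (Game Ω) where
  carrier := {ν | ν ∈ BV Ω ∧ ∃ μ, Dominates μ ν}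
  zero_mem' := ⟨zero_mem _, 0, dominates_iff.2
    ⟨⟨zero_mem _, fun _ => le_rfl⟩, fun _ _ _ => by simp⟩⟩
  add_mem' := by
    rintro a b ⟨ha, μ, hμ⟩ ⟨hb, μ', hμ'⟩
    exact ⟨add_mem ha hb, μ + μ', hμ.add hμ'⟩
  smul_mem' := by
    rintro c a ⟨ha, μ, hμ⟩
    exact ⟨(BV Ω).smul_mem c ha, _, hμ.smul c⟩

/-- `‖ν‖_∞ = inf {μ(Ω) : μ ∈ NA⁺, -μ ≼ ν ≼ μ}`. -/
def lipNorm (ν : Game Ω) : ℝ := sInf {r | ∃ μ, Dominates μ ν ∧ r = μ ⊤}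

theorem lipNorm_bddBelow (ν : Game Ω) : BddBelow {r | ∃ μ, Dominates μ ν ∧ r = μ ⊤} :=
  ⟨0, by rintro _ ⟨μ, hμ, rfl⟩; exact hμ.1.2 _⟩

theorem lipNorm_nonneg (ν : Game Ω) : 0 ≤ lipNorm ν :=
  Real.sInf_nonneg (by rintro _ ⟨μ, hμ, rfl⟩; exact hμ.1.2 _)

theorem lipNorm_le {μ ν : Game Ω} (h : Dominates μ ν) : lipNorm ν ≤ μ ⊤ :=
  csInf_le (lipNorm_bddBelow ν) ⟨μ, h, rfl⟩

theorem exists_lt_lipNorm_add {ν : Game Ω} (hν : ν ∈ ACInf Ω) {ε : ℝ} (hε : 0 < ε) :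
    ∃ μ, Dominates μ ν ∧ μ ⊤ < lipNorm ν + ε := by
  obtain ⟨μ₀, h₀⟩ := hν.2
  obtain ⟨_, ⟨μ, hμ, rfl⟩, hlt⟩ := exists_lt_of_csInf_lt (s := {r | ∃ μ, Dominates μ ν ∧ r = μ ⊤})
    ⟨_, μ₀, h₀, rfl⟩ (lt_add_of_pos_right (lipNorm ν) hε)
  exact ⟨μ, hμ, hlt⟩

theorem lipNorm_smul_le (c : ℝ) {ν : Game Ω} (hν : ν ∈ ACInf Ω) :
    lipNorm (c • ν) ≤ |c| * lipNorm ν := by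
  refine le_of_forall_pos_le_add fun ε hε => ?_
  obtain ⟨μ, hμ, hlt⟩ := exists_lt_lipNorm_add hν (ε := ε / (|c| + 1)) (by positivity)
  have h1 := lipNorm_le (hμ.smul c)
  rw [Game.smul_apply] at h1
  have h2 : |c| * μ ⊤ ≤ |c| * (lipNorm ν + ε / (|c| + 1)) :=
    mul_le_mul_of_nonneg_left hlt.le (abs_nonneg c)
  have h3 : |c| * (ε / (|c| + 1)) ≤ ε := by
    rw [mul_div_assoc', div_le_iff₀ (by positivity)]
    nlinarith [abs_nonneg c]
  linarith

instance : Norm (ACInf Ω) := ⟨fun ν => lipNorm (ν : Game Ω)⟩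

theorem norm_def (ν : ACInf Ω) : ‖ν‖ = lipNorm (ν : Game Ω) := rfl

theorem normedCore : NormedSpace.Core ℝ (ACInf Ω) where
  norm_nonneg ν := lipNorm_nonneg _
  norm_smul c ν := by
    refine le_antisymm (lipNorm_smul_le c ν.2) ?_
    rcases eq_or_ne c 0 with rfl | hc
    · rw [norm_zero, zero_mul]
      exact lipNorm_nonneg _
    · have h := lipNorm_smul_le c⁻¹ ((ACInf Ω).smul_mem c ν.2)
      rw [inv_smul_smul₀ hc, abs_inv] at h
      rw [Real.norm_eq_abs]
      change |c| * lipNorm (ν : Game Ω) ≤ lipNorm (c • (ν : Game Ω))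
      have hc' := abs_pos.2 hc
      calc |c| * lipNorm (ν : Game Ω) ≤ |c| * (|c|⁻¹ * lipNorm (c • (ν : Game Ω))) :=
            mul_le_mul_of_nonneg_left h hc'.le
        _ = lipNorm (c • (ν : Game Ω)) := by field_simp
  norm_triangle ν ν' := by
    refine le_of_forall_pos_le_add fun ε hε => ?_
    obtain ⟨μ, hμ, h1⟩ := exists_lt_lipNorm_add ν.2 (half_pos hε)
    obtain ⟨μ', hμ', h2⟩ := exists_lt_lipNorm_add ν'.2 (half_pos hε)
    have h3 := lipNorm_le (hμ.add hμ')
    rw [Game.add_apply] at h3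
    change lipNorm ((ν : Game Ω) + (ν' : Game Ω)) ≤ lipNorm (ν : Game Ω) + lipNorm (ν' : Game Ω) + ε
    linarith
  norm_eq_zero_iff ν := by
    constructor
    · intro h
      rw [norm_def] at h
      refine Subtype.ext (Game.ext fun S => ?_)
      change (ν : Game Ω) S = 0
      refine abs_eq_zero.1 (le_antisymm (le_of_forall_pos_le_add fun ε hε => ?_) (abs_nonneg _))
      obtain ⟨μ, hμ, h1⟩ := exists_lt_lipNorm_add ν.2 hε
      have h2 := (dominates_iff.1 hμ).2 ⊥ S bot_le
      have h3 : μ S ≤ μ ⊤ := NA_isMonotone hμ.1 le_top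
      simp only [Game.map_bot, sub_zero] at h2
      linarith
    · rintro rfl
      refine le_antisymm ?_ (lipNorm_nonneg _)
      exact lipNorm_le (μ := 0) (dominates_iff.2
        ⟨⟨zero_mem _, fun _ => le_rfl⟩, fun _ _ _ => by simp⟩)

/-- `AC_∞` carries the topology of the norm `‖·‖_∞`. -/
instance : NormedAddCommGroup (ACInf Ω) := NormedAddCommGroup.ofCore normedCore

instance : NormedSpace ℝ (ACInf Ω) := NormedSpace.ofCore normedCore

theorem measure_mem_NAPos {m : Measure Ω} [IsFiniteMeasure m] (h : ∀ x, m {x} = 0) {ν : Game Ω}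
    (hν : ∀ S : Coalition Ω, ν S = m.real (S : Set Ω)) : ν ∈ NAPos Ω := by
  refine ⟨⟨m.toSignedMeasure, (isNonatomic_iff _).2 fun x => ?_, fun S => ?_⟩, fun S => ?_⟩
  · rw [Measure.toSignedMeasure_apply_measurable (measurableSet_singleton x), measureReal_def, h x,
      ENNReal.toReal_zero]
  · rw [Measure.toSignedMeasure_apply_measurable S.2, hν]
  · change 0 ≤ ν S
    rw [hν]
    exact measureReal_nonneg

/-- Every nonatomic measure is a Lipschitz game. -/
theorem NA_le_ACInf : NA Ω ≤ ACInf Ω := by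
  rintro ν ⟨s, hs, hν⟩
  rw [isNonatomic_iff] at hs
  have h0 : ∀ x, s.toJordanDecomposition.posPart {x} = 0 ∧
      s.toJordanDecomposition.negPart {x} = 0 := fun x => by
    have := totalVariation_singleton (hs x)
    rwa [SignedMeasure.totalVariation, Measure.add_apply, add_eq_zero] at this
  let p : Game Ω := ⟨fun S => s.toJordanDecomposition.posPart.real (S : Set Ω), measureReal_empty⟩
  let q : Game Ω := ⟨fun S => s.toJordanDecomposition.negPart.real (S : Set Ω), measureReal_empty⟩
  have hp : p ∈ NAPos Ω := measure_mem_NAPos (fun x => (h0 x).1) (fun _ => rfl)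
  have hq : q ∈ NAPos Ω := measure_mem_NAPos (fun x => (h0 x).2) (fun _ => rfl)
  have hpq : ν = p - q := Game.ext fun S => by
    rw [hν, toJordan_apply s S.2]
    rfl
  refine ⟨⟨p, q, NA_isMonotone hp, NA_isMonotone hq, hpq⟩, p + q, NAPos_add hp hq, ?_, ?_⟩
  · intro S T hST
    have := NA_isMonotone hp hST
    simp only [hpq, Game.sub_apply, Game.neg_apply, Game.add_apply]
    linarith
  · intro S T hST
    have := NA_isMonotone hq hST
    simp only [hpq, Game.sub_apply, Game.add_apply]
    linarith

/-- `m` is the Burkill-Cesari integral `∂⁺_∅(ν, ·)` of `ν`, with respect to the mesh `δ_λ` of some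
`λ ∈ NA⁺`. -/
def IsBCIntegral (ν : Game Ω) (m : Coalition Ω → ℝ) : Prop :=
  ∃ lam ∈ NAPos Ω, HasBCIntegral lam ν m

variable (Ω) in
/-- The space `BC` of Burkill-Cesari integrable games. -/
def BC : Submodule ℝ (Game Ω) where
  carrier := {ν | ∃ m, IsBCIntegral ν m}
  zero_mem' := ⟨0, 0, ⟨zero_mem _, fun _ => le_rfl⟩, fun E ε hε => ⟨1, one_pos, fun D _ => by
    simpa using hε⟩⟩
  add_mem' := by
    rintro a b ⟨m, l, hl, h⟩ ⟨m', l', hl', h'⟩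
    refine ⟨m + m', l + l', NAPos_add hl hl', ?_⟩
    replace h : HasBCIntegral (l + l') a m := h.mono fun S => le_add_of_nonneg_right (hl'.2 S)
    replace h' : HasBCIntegral (l + l') b m' := h'.mono fun S => le_add_of_nonneg_left (hl.2 S)
    intro E ε hε
    obtain ⟨δ, hδ, H⟩ := h E (ε / 2) (half_pos hε)
    obtain ⟨δ', hδ', H'⟩ := h' E (ε / 2) (half_pos hε)
    refine ⟨min δ δ', lt_min hδ hδ', fun D hD => ?_⟩
    have h1 := abs_lt.1 (H D fun I hI => (hD I hI).trans_le (min_le_left _ _))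
    have h2 := abs_lt.1 (H' D fun I hI => (hD I hI).trans_le (min_le_right _ _))
    simp only [Game.add_apply, Finset.sum_add_distrib, Pi.add_apply]
    rw [abs_lt]
    constructor <;> linarith
  smul_mem' := by
    rintro c a ⟨m, l, hl, h⟩
    refine ⟨c • m, l, hl, fun E ε hε => ?_⟩
    obtain ⟨δ, hδ, H⟩ := h E (ε / (|c| + 1)) (by positivity)
    refine ⟨δ, hδ, fun D hD => ?_⟩
    have h1 := H D hD
    simp only [Game.smul_apply, Pi.smul_apply, smul_eq_mul, ← Finset.mul_sum, ← mul_sub, abs_mul]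
    calc |c| * |∑ I ∈ D.parts, a I - m E| ≤ |c| * (ε / (|c| + 1)) :=
          mul_le_mul_of_nonneg_left h1.le (abs_nonneg c)
      _ < ε := by
          rw [mul_div_assoc', div_lt_iff₀ (by positivity)]
          nlinarith [abs_nonneg c]

variable (Ω) in
/-- `Q = BC ∩ AC_∞`, as a subspace of `AC_∞`. -/
def Q : Submodule ℝ (ACInf Ω) := (BC Ω).comap (ACInf Ω).subtype

variable (Ω) in
/-- `Y`, the `‖·‖_∞`-closure of `Q` in `AC_∞`. -/
def Y : Submodule ℝ (ACInf Ω) := (Q Ω).topologicalClosure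

/-- The power `μᵏ` of a nonatomic probability measure is a Lipschitz game. -/
theorem pow_mem_ACInf {μ ν : Game Ω} (hμ : μ ∈ NAProb Ω) {k : ℕ}
    (h : ∀ S, ν S = μ S ^ k) : ν ∈ ACInf Ω := by
  have hmono := NA_isMonotone hμ.1
  have h01 : ∀ S, 0 ≤ μ S ∧ μ S ≤ 1 := fun S => ⟨hμ.1.2 S, hμ.2 ▸ hmono le_top⟩
  refine ⟨⟨ν, 0, fun S T hST => ?_, fun _ _ _ => le_rfl, by simp⟩, (k : ℝ) • μ, dominates_iff.2
    ⟨NAPos_smul k.cast_nonneg hμ.1, fun S T hST => ?_⟩⟩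
  · rw [h, h]
    exact pow_le_pow_left₀ (h01 S).1 (hmono hST) k
  · have hm : μ S ≤ μ T := hmono hST
    simp only [h, Game.smul_apply]
    rw [abs_of_nonneg (sub_nonneg.2 (pow_le_pow_left₀ (h01 S).1 hm k))]
    clear h
    induction k with
    | zero => simp
    | succ n ih =>
      have h1 : μ T ^ n ≤ 1 := pow_le_one₀ (h01 T).1 (h01 T).2
      have h2 : μ S ^ n ≤ μ T ^ n := pow_le_pow_left₀ (h01 S).1 hm n
      have h3 : 0 ≤ μ T ^ n := pow_nonneg (h01 T).1 n
      have h4 := (h01 S).1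
      have h5 := (h01 S).2
      push_cast
      rw [pow_succ, pow_succ]
      nlinarith [mul_nonneg (sub_nonneg.2 h1) (sub_nonneg.2 hm),
        mul_nonneg (sub_nonneg.2 h2) (sub_nonneg.2 h5)]

variable (Ω) in
/-- `pNA_∞`, as a subspace of `AC_∞`: the `‖·‖_∞`-closure of the linear span of the powers `μᵏ`,
`k ≥ 1`, of nonatomic probability measures `μ` (all these powers lie in `AC_∞`). -/
def pNAInf : Submodule ℝ (ACInf Ω) :=
  (Submodule.span ℝ {ν : ACInf Ω | ∃ μ ∈ NAProb Ω, ∃ k : ℕ, 1 ≤ k ∧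
    ∀ S : Coalition Ω, (ν : Game Ω) S = μ S ^ k}).topologicalClosure

/-- `ϑ_* ν`, where `(ϑ_* ν)(E) = ν(ϑ(E))`, for an automorphism `ϑ` of `(Ω, Σ)`. -/
def act (θ : Ω ≃ᵐ Ω) (ν : Game Ω) : Game Ω :=
  ⟨fun E => ν ⟨θ '' (E : Set Ω), θ.measurableSet_image.2 E.2⟩, by
    change ν ⟨θ '' (∅ : Set Ω), _⟩ = 0
    have : (⟨θ '' (∅ : Set Ω), θ.measurableSet_image.2 MeasurableSet.empty⟩ : Coalition Ω) = ⊥ :=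
      Subtype.ext (image_empty _)
    rw [this, Game.map_bot]⟩

/-- A linear space of games is symmetric if it is invariant under every `ϑ_*`. -/
def IsSymmetric (V : Submodule ℝ (Game Ω)) : Prop :=
  ∀ (θ : Ω ≃ᵐ Ω), ∀ ν ∈ V, act θ ν ∈ V

/-- A semivalue: a linear map `φ : V → NA` on a symmetric subspace `V` of `BV` which commutes with
automorphisms, is positive, and is the identity on `NA ∩ V`. -/
structure IsSemivalue (V : Submodule ℝ (Game Ω)) (φ : V →ₗ[ℝ] NA Ω) : Prop where
  le_BV : V ≤ BV Ω
  isSymmetric : IsSymmetric V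
  symmetry : ∀ (θ : Ω ≃ᵐ Ω) (ν : V),
    act θ (φ ν : Game Ω) = (φ ⟨act θ ν, isSymmetric θ ν ν.2⟩ : Game Ω)
  positivity : ∀ ν : V, (ν : Game Ω).IsMonotone → 0 ≤ (φ ν : Game Ω)
  identity : ∀ ν : V, (ν : Game Ω) ∈ NA Ω → (φ ν : Game Ω) = ν

/-- `D^ν = {λ ∈ NA : ν ≼ λ}`. -/
def upperMeasures (ν : Game Ω) : Set (NA Ω) := {lam | ν.Prec lam}

/-- `D_ν = {λ ∈ NA : λ ≼ ν}`. -/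
def lowerMeasures (ν : Game Ω) : Set (NA Ω) := {lam | Game.Prec lam ν}

/-- A Milnor operator: a linear map `ψ : W → NA` on a linear space `NA ⊆ W ⊆ AC_∞` such that
`ν_* ≤ ψ ν ≤ ν^*` for all `ν ∈ W`, where `ν_* = l.u.b. D_ν` and `ν^* = g.l.b. D^ν` in `NA`
(ordered setwise). -/
structure IsMilnor (W : Submodule ℝ (Game Ω)) (ψ : W →ₗ[ℝ] NA Ω) : Prop where
  NA_le : NA Ω ≤ W
  le_ACInf : W ≤ ACInf Ω
  between : ∀ ν : W, ∃ lo hi : NA Ω, IsLUB (lowerMeasures (ν : Game Ω)) lo ∧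
    IsGLB (upperMeasures (ν : Game Ω)) hi ∧ lo ≤ ψ ν ∧ ψ ν ≤ hi

/-- `Φ` is an extended Burkill-Cesari integral: a Milnor operator on all of `AC_∞` which extends
the Burkill-Cesari integral on `Q = BC ∩ AC_∞`. -/
structure IsExtendedBC (Φ : ACInf Ω →ₗ[ℝ] NA Ω) : Prop where
  isMilnor : IsMilnor (ACInf Ω) Φ
  extends_BC : ∀ ν ∈ Q Ω, IsBCIntegral (ν : Game Ω) (Φ ν : Game Ω)

end Basic

end NonatomicGames

end

open Filter Topology

namespace NonatomicGames

/-! ### Finitely additive set functions and finite partitions. -/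

section Additivity

variable {Ω : Type*} [MeasurableSpace Ω]

theorem Coalition.coe_disjoint {A B : Coalition Ω} (h : Disjoint A B) :
    Disjoint (A : Set Ω) (B : Set Ω) := by
  rw [disjoint_iff] at h
  rw [Set.disjoint_iff_inter_eq_empty]
  exact congrArg Subtype.val h

/-- Finite additivity of a set function on the coalitions. -/
def IsAdditive (f : Coalition Ω → ℝ) : Prop :=
  ∀ A B : Coalition Ω, Disjoint A B → f (A ⊔ B) = f A + f B

theorem IsAdditive.sdiff {f : Coalition Ω → ℝ} (hf : IsAdditive f) {A B : Coalition Ω}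
    (h : A ≤ B) : f (B \ A) = f B - f A := by
  have := hf A (B \ A) disjoint_sdiff_self_right
  rw [sup_sdiff_cancel_right h] at this
  linarith

theorem IsAdditive.sum_eq_sup {f : Coalition Ω → ℝ} (hf : IsAdditive f) (h0 : f ⊥ = 0)
    {ι : Type*} (s : Finset ι) (A : ι → Coalition Ω)
    (hA : (s : Set ι).PairwiseDisjoint A) : ∑ i ∈ s, f (A i) = f (s.sup A) := by
  classical
  induction s using Finset.induction_on with
  | empty => simp [h0]
  | insert a s ha ih =>
    rw [Finset.sum_insert ha, Finset.sup_insert, hf, ih]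
    · exact hA.subset (by simp)
    · rw [Finset.disjoint_sup_right]
      intro i hi
      exact hA (by simp) (by simp [hi]) (fun h => ha (h ▸ hi))

theorem IsAdditive.sum_parts {f : Coalition Ω → ℝ} (hf : IsAdditive f) (h0 : f ⊥ = 0)
    {E : Coalition Ω} (D : Finpartition E) : ∑ I ∈ D.parts, f I = f E := by
  have := hf.sum_eq_sup h0 D.parts id D.supIndep.pairwiseDisjoint
  rwa [D.sup_parts] at this

/-- A finite cover by coalitions with a hereditary property can be made disjoint. -/
theorem exists_finpartition_sup (p : Coalition Ω → Prop) (hp : ∀ A B, A ≤ B → p B → p A)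
    (s : Finset (Coalition Ω)) (hs : ∀ A ∈ s, p A) :
    ∃ D : Finpartition (s.sup id), ∀ I ∈ D.parts, p I := by
  classical
  induction s using Finset.induction_on with
  | empty => exact ⟨Finpartition.empty _, by simp⟩
  | insert a s ha ih =>
    obtain ⟨D, hD⟩ := ih fun A hA => hs A (by simp [hA])
    have hle : s.sup id ≤ (insert a s).sup id := Finset.sup_mono (by simp)
    -- The only possible new block is the part of `a` not yet covered, which inherits `p` from `a`.
    refine ⟨D.extendOfLE hle, fun I hI => ?_⟩
    rcases D.mem_parts_or_eq_sdiff_of_mem_extendOfLE hle hI with h | h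
    · exact hD I h
    · refine hp I a ?_ (hs a (by simp))
      rw [h, Finset.sup_insert, id, sup_sdiff_right_self]
      exact sdiff_le

/-- Going through covers avoids separating off the cases `A = ⊥` and `A = ⊤`, in which `{A, Aᶜ}` has
a forbidden empty block. -/
theorem exists_finpartition_le_or_le_compl (A : Coalition Ω) :
    ∃ D : Finpartition (⊤ : Coalition Ω), ∀ I ∈ D.parts, I ≤ A ∨ I ≤ Aᶜ := by
  classical
  obtain ⟨D, hD⟩ := exists_finpartition_sup (fun I => I ≤ A ∨ I ≤ Aᶜ)
    (fun _ _ h h' => h'.imp h.trans h.trans) {A, Aᶜ} (by simp)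
  exact ⟨D.copy (by simp), by simpa using hD⟩

theorem Game.Prec.le {μ ν : Game Ω} (h : μ.Prec ν) : μ ≤ ν := fun S => by
  have := h (bot_le : (⊥ : Coalition Ω) ≤ S)
  simp only [Game.sub_apply, Game.map_bot] at this
  linarith

theorem Game.IsMonotone.act (θ : Ω ≃ᵐ Ω) {ν : Game Ω} (h : ν.IsMonotone) : (act θ ν).IsMonotone :=
  fun S T hST => h (show θ '' (S : Set Ω) ⊆ θ '' (T : Set Ω) from image_mono hST)

/-- The sum of a game over the trace on a coalition of a finite partition. -/
def traceSum (ν : Game Ω) (S : Coalition Ω) (D : Finpartition (⊤ : Coalition Ω)) : ℝ :=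
  ∑ I ∈ D.parts, ν (I ⊓ S)

/-- Restriction discards the empty traces, which contribute `ν ⊥ = 0`. -/
theorem traceSum_eq_restrict [DecidableEq (Coalition Ω)] (ν : Game Ω) (S : Coalition Ω)
    (D : Finpartition (⊤ : Coalition Ω)) :
    traceSum ν S D = ∑ I ∈ (D.restrict (le_top : S ≤ ⊤)).parts, ν I :=
  (D.sum_restrict le_top ν ν.map_bot).symm

theorem traceSum_of_isAdditive {μ : Game Ω} (hμ : IsAdditive μ) (S : Coalition Ω)
    (D : Finpartition (⊤ : Coalition Ω)) : traceSum μ S D = μ S := by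
  classical
  rw [traceSum_eq_restrict, hμ.sum_parts μ.map_bot]

theorem traceSum_mono {μ ν : Game Ω} (h : μ ≤ ν) (S : Coalition Ω)
    (D : Finpartition (⊤ : Coalition Ω)) : traceSum μ S D ≤ traceSum ν S D :=
  Finset.sum_le_sum fun _ _ => h _

variable (Ω) in
/-- An ultrafilter on the finite partitions of `Ω` along which partitions become arbitrarily
fine. -/
theorem exists_ultrafilter_finpartition :
    ∃ U : Ultrafilter (Finpartition (⊤ : Coalition Ω)),
      ∀ P, ∀ᶠ D in (U : Filter (Finpartition (⊤ : Coalition Ω))), D ≤ P := by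
  classical
  -- Finer partitions are smaller, and common refinements make `atBot` a proper filter.
  exact ⟨Ultrafilter.of atBot, fun P => Ultrafilter.of_le _ (eventually_le_atBot P)⟩

theorem act_top (θ : Ω ≃ᵐ Ω) (ν : Game Ω) : act θ ν ⊤ = ν ⊤ := by
  have h : (⟨θ '' (univ : Set Ω), θ.measurableSet_image.2 MeasurableSet.univ⟩ : Coalition Ω) = ⊤ :=
    Subtype.ext (image_univ_of_surjective θ.surjective)
  exact congrArg ν h

end Additivity

/-! ### Nonatomic measures, small meshes and integrals of powers. -/

section Measures

variable {Ω : Type*} [MeasurableSpace Ω] [StandardBorelSpace Ω]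

theorem isAdditive_of_mem_NA {μ : Game Ω} (hμ : μ ∈ NA Ω) : IsAdditive μ := by
  obtain ⟨s, -, hs⟩ := hμ
  intro A B h
  rw [hs, hs, hs]
  exact VectorMeasure.of_union (Coalition.coe_disjoint h) A.2 B.2

/-- A finitely additive set function dominated by a nonatomic measure is a nonatomic measure. -/
theorem mem_NA_of_isAdditive {μ ν : Game Ω} (hμ : μ ∈ NAPos Ω) (hν : IsAdditive ν)
    (h : ∀ S, |ν S| ≤ μ S) : ν ∈ NA Ω := by
  classical
  have hμa := isAdditive_of_mem_NA hμ.1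
  obtain ⟨⟨t, ht, hμt⟩, hpos⟩ := hμ
  rw [isNonatomic_iff] at ht
  let f : Set Ω → ℝ := fun A => if hA : MeasurableSet A then ν ⟨A, hA⟩ else 0
  have hf : ∀ S : Coalition Ω, f S = ν S := fun S => by simp [f, S.2]
  let s : SignedMeasure Ω :=
    { measureOf' := f
      empty' := (hf ⊥).trans ν.map_bot
      not_measurable' := fun i hi => by simp [f, hi]
      m_iUnion' := fun {A} hA hd => by
        let B : ℕ → Coalition Ω := fun i => ⟨A i, hA i⟩
        let U : Coalition Ω := ⟨⋃ i, A i, MeasurableSet.iUnion hA⟩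
        have hB : ∀ s : Finset ℕ, (s : Set ℕ).PairwiseDisjoint B := fun s i _ j _ hij => by
          rw [Function.onFun, disjoint_iff]
          exact Subtype.ext (Set.disjoint_iff_inter_eq_empty.1 (hd hij))
        have hle : ∀ s : Finset ℕ, s.sup B ≤ U := fun s =>
          Finset.sup_le fun i _ => show A i ⊆ _ from subset_iUnion A i
        have hs : HasSum (fun i => μ (B i)) (μ U) := by
          simp only [hμt]
          exact t.hasSum_of_disjoint_iUnion hA hd
        change HasSum (fun i => f (B i)) (f U)
        simp only [hf]
        rw [HasSum, tendsto_iff_norm_sub_tendsto_zero] at hs ⊢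
        -- The error of a partial sum is `ν` of the uncovered part of `U`, at most `μ` of that part,
        -- which tends to `0`.
        refine squeeze_zero (fun _ => norm_nonneg _) (fun s => ?_) hs
        rw [hν.sum_eq_sup ν.map_bot s B (hB s), hμa.sum_eq_sup μ.map_bot s B (hB s)]
        have h1 := h (U \ s.sup B)
        rw [hν.sdiff (hle s), hμa.sdiff (hle s)] at h1
        rw [norm_sub_rev, Real.norm_eq_abs, norm_sub_rev, Real.norm_eq_abs]
        exact h1.trans (le_abs_self _) }
  refine ⟨s, (isNonatomic_iff _).2 fun x => ?_, fun S => (hf S).symm⟩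
  have h1 := h ⟨{x}, measurableSet_singleton x⟩
  rw [hμt] at h1
  change f ({x} : Set Ω) = 0
  rw [show f ({x} : Set Ω) = _ from hf ⟨{x}, measurableSet_singleton x⟩]
  exact abs_nonpos_iff.1 (h1.trans (ht x).le)

/-- Gives access to outer regularity and to the complete lattice of measures. -/
theorem exists_measure_of_mem_NAPos {μ : Game Ω} (hμ : μ ∈ NAPos Ω) :
    ∃ m : Measure Ω, IsFiniteMeasure m ∧ (∀ x, m {x} = 0) ∧
      ∀ S : Coalition Ω, μ S = m.real (S : Set Ω) := by
  obtain ⟨⟨s, hs, hμs⟩, hpos⟩ := hμ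
  rw [isNonatomic_iff] at hs
  have h0 : 0 ≤[univ] s := by
    rw [VectorMeasure.le_restrict_univ_iff_le]
    intro A hA
    have := hpos ⟨A, hA⟩
    change 0 ≤ μ _ at this
    rwa [hμs] at this
  have hr : ∀ S : Set Ω, MeasurableSet S →
      (s.toMeasureOfZeroLE univ MeasurableSet.univ h0).real S = s S := fun S hS => by
    rw [SignedMeasure.toMeasureOfZeroLE_real_apply _ _ _ hS, univ_inter]
  refine ⟨s.toMeasureOfZeroLE univ MeasurableSet.univ h0, inferInstance, fun x => ?_, fun S => ?_⟩
  · rw [← measureReal_eq_zero_iff, hr _ (measurableSet_singleton x), hs]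
  · rw [hr _ S.2, hμs]

/-- Points are null, so outer regularity gives each an open neighbourhood of mass below `δ`. By the
Lindelöf property countably many of these cover `Ω`, and finitely many leave a remainder of mass
below `δ`; this finite cover is then made disjoint. -/
theorem exists_finpartition_top_lt {lam : Game Ω} (h : lam ∈ NAPos Ω) {δ : ℝ} (hδ : 0 < δ) :
    ∃ D : Finpartition (⊤ : Coalition Ω), ∀ I ∈ D.parts, lam I < δ := by
  classical
  obtain ⟨m, hm, hm0, hlm⟩ := exists_measure_of_mem_NAPos h
  have hmono := NA_isMonotone h
  rcases isEmpty_or_nonempty Ω with hΩ | hΩ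
  · refine ⟨(Finpartition.empty _).copy (Subtype.ext (Subsingleton.elim _ _)), by simp⟩
  -- A compatible Polish topology supplies both regularity and the Lindelöf property.
  let := upgradeStandardBorel Ω
  have hU : ∀ x : Ω, ∃ U : Set Ω, IsOpen U ∧ x ∈ U ∧ m.real U < δ := fun x => by
    obtain ⟨U, hxU, hUo, hlt⟩ := Set.exists_isOpen_lt_of_lt (μ := m) {x} (ENNReal.ofReal δ)
      (by rw [hm0]; simpa using hδ)
    exact ⟨U, hUo, hxU rfl, by
      rw [measureReal_def]; exact (ENNReal.lt_ofReal_iff_toReal_lt (measure_ne_top _ _)).1 hlt⟩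
  choose U hUo hxU hUlt using hU
  obtain ⟨c, hc, hcov⟩ := TopologicalSpace.countable_cover_nhds fun x => (hUo x).mem_nhds (hxU x)
  have hcne : c.Nonempty := by
    by_contra hne
    rw [not_nonempty_iff_eq_empty] at hne
    simp [hne] at hcov
    exact (univ_nonempty (α := Ω)).ne_empty hcov.symm
  obtain ⟨g, rfl⟩ := hc.exists_eq_range hcne
  rw [biUnion_range] at hcov
  have htend := tendsto_measure_iUnion_accumulate (μ := m) (f := fun n => U (g n))
  rw [hcov] at htend
  have htend' : Tendsto (fun n => m.real (accumulate (fun n => U (g n)) n)) atTop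
      (𝓝 (m.real univ)) := (ENNReal.tendsto_toReal (measure_ne_top _ _)).comp htend
  obtain ⟨N, hN⟩ := (htend'.eventually (lt_mem_nhds (sub_lt_self (m.real univ) hδ))).exists
  let V : ℕ → Coalition Ω := fun n => ⟨U (g n), (hUo _).measurableSet⟩
  let W : Coalition Ω := (Finset.range (N + 1)).sup V
  have hW : accumulate (fun n => U (g n)) N ⊆ (W : Set Ω) := by
    intro x hx
    obtain ⟨n, hn, hx⟩ := mem_accumulate.1 hx
    exact (Finset.le_sup (f := V) (Finset.mem_range.2 (Nat.lt_succ_of_le hn)) : V n ≤ W) hx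
  have hWc : lam Wᶜ < δ := by
    have h1 := (isAdditive_of_mem_NA h.1).sdiff (le_top : W ≤ ⊤)
    rw [top_sdiff] at h1
    rw [h1, hlm, hlm]
    have h2 := measureReal_mono (μ := m) hW
    change m.real univ - _ < δ
    linarith
  obtain ⟨D, hD⟩ := exists_finpartition_sup (fun I => lam I < δ)
    (fun A B hAB hB => (hmono hAB).trans_lt hB) (insert Wᶜ ((Finset.range (N + 1)).image V)) (by
      intro A hA
      rcases Finset.mem_insert.1 hA with rfl | hA
      · exact hWc
      · obtain ⟨n, -, rfl⟩ := Finset.mem_image.1 hA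
        rw [hlm]
        exact hUlt _)
  have htop : (insert Wᶜ ((Finset.range (N + 1)).image V)).sup id = ⊤ := by
    rw [Finset.sup_insert, Finset.sup_image, Function.id_comp, id]
    exact compl_sup_eq_top
  exact ⟨D.copy htop, hD⟩

theorem exists_finpartition_lt {lam : Game Ω} (h : lam ∈ NAPos Ω) (E : Coalition Ω) {δ : ℝ}
    (hδ : 0 < δ) : ∃ D : Finpartition E, ∀ I ∈ D.parts, lam I < δ := by
  classical
  obtain ⟨D, hD⟩ := exists_finpartition_top_lt h hδ
  refine ⟨D.restrict le_top, fun I hI => ?_⟩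
  simp only [Finpartition.restrict, Finset.mem_erase, Finset.mem_image] at hI
  obtain ⟨-, J, hJ, rfl⟩ := hI
  exact (NA_isMonotone h inf_le_left).trans_lt (hD J hJ)

/-- Both meshes are controlled by that of `lam + lam'`. Partitions of small mesh exist by
nonatomicity; otherwise the convergence would be vacuous. -/
theorem HasBCIntegral.unique {lam lam' ν : Game Ω} {m m' : Coalition Ω → ℝ}
    (hlam : lam ∈ NAPos Ω) (hlam' : lam' ∈ NAPos Ω) (h : HasBCIntegral lam ν m)
    (h' : HasBCIntegral lam' ν m') : m = m' := by
  replace h : HasBCIntegral (lam + lam') ν m := h.mono fun S => le_add_of_nonneg_right (hlam'.2 S)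
  replace h' : HasBCIntegral (lam + lam') ν m' := h'.mono fun S => le_add_of_nonneg_left (hlam.2 S)
  funext E
  refine eq_of_forall_dist_le fun ε hε => ?_
  obtain ⟨δ, hδ, H⟩ := h E (ε / 2) (half_pos hε)
  obtain ⟨δ', hδ', H'⟩ := h' E (ε / 2) (half_pos hε)
  obtain ⟨D, hD⟩ := exists_finpartition_lt (NAPos_add hlam hlam') E (lt_min hδ hδ')
  have h1 := abs_lt.1 (H D fun I hI => (hD I hI).trans_le (min_le_left _ _))
  have h2 := abs_lt.1 (H' D fun I hI => (hD I hI).trans_le (min_le_right _ _))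
  rw [Real.dist_eq, abs_le]
  constructor <;> linarith

theorem IsBCIntegral.unique {ν : Game Ω} {m m' : Coalition Ω → ℝ} (h : IsBCIntegral ν m)
    (h' : IsBCIntegral ν m') : m = m' := by
  obtain ⟨l, hl, h⟩ := h
  obtain ⟨l', hl', h'⟩ := h'
  exact h.unique hl hl' h'

theorem isBCIntegral_pow {μ ν : Game Ω} (hμ : μ ∈ NAProb Ω) {k : ℕ} (hk : 1 ≤ k)
    (h : ∀ S, ν S = μ S ^ k) : IsBCIntegral ν (fun S => if k = 1 then μ S else 0) := by
  have hadd := isAdditive_of_mem_NA hμ.1.1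
  have hle : ∀ S, μ S ≤ 1 := fun S => hμ.2 ▸ NA_isMonotone hμ.1 le_top
  have h0 : ∀ S, 0 ≤ μ S := hμ.1.2
  -- For `k ≥ 2` the sums are at most `δ · μ E ≤ δ`; taking `δ = ε / 2` gives the strict inequality.
  refine ⟨μ, hμ.1, fun E ε hε => ⟨ε / 2, half_pos hε, fun D hD => ?_⟩⟩
  rcases hk.eq_or_lt with rfl | hk
  · simp only [h, pow_one, if_true]
    rw [hadd.sum_parts μ.map_bot]
    simpa using hε
  · beta_reduce
    rw [if_neg hk.ne', sub_zero, abs_of_nonneg (Finset.sum_nonneg fun I _ => by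
      rw [h]; exact pow_nonneg (h0 I) k)]
    calc ∑ I ∈ D.parts, ν I ≤ ∑ I ∈ D.parts, ε / 2 * μ I := by
          refine Finset.sum_le_sum fun I hI => ?_
          rw [h]
          calc μ I ^ k ≤ μ I ^ 2 := pow_le_pow_of_le_one (h0 I) (hle I) hk
            _ = μ I * μ I := sq _
            _ ≤ ε / 2 * μ I := mul_le_mul_of_nonneg_right (hD I hI).le (h0 I)
      _ = ε / 2 * μ E := by rw [← Finset.mul_sum, hadd.sum_parts μ.map_bot]
      _ ≤ ε / 2 * 1 := mul_le_mul_of_nonneg_left (hle E) (half_pos hε).le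
      _ < ε := by linarith

variable (Ω) in
theorem pNAInf_le_Y : pNAInf Ω ≤ Y Ω := by
  refine Submodule.topologicalClosure_mono (Submodule.span_le.2 ?_)
  rintro ν ⟨μ, hμ, k, hk, h⟩
  exact ⟨_, isBCIntegral_pow hμ hk h⟩

end Measures

/-! ### Existence of the bounds `ν_*` and `ν^*`. -/

section Bounds

variable {Ω : Type*} [MeasurableSpace Ω] [StandardBorelSpace Ω]

/-- A nonnegative measure is monotone, so on `NA` the setwise order implies `≼`; `Game.Prec.le` is
the converse. -/
theorem prec_of_le {μ ν : Game Ω} (hμ : μ ∈ NA Ω) (hν : ν ∈ NA Ω) (h : μ ≤ ν) : μ.Prec ν :=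
  NA_isMonotone ⟨sub_mem hν hμ, fun S => sub_nonneg.2 (h S)⟩

theorem dominates_of_abs_le {μ ν : Game Ω} (hμ : μ ∈ NAPos Ω) (hν : ν ∈ NA Ω)
    (h : ∀ S, |ν S| ≤ μ S) : Dominates μ ν :=
  ⟨hμ, prec_of_le (neg_mem hμ.1) hν fun S => (abs_le.1 (h S)).1,
    prec_of_le hν hμ.1 fun S => (abs_le.1 (h S)).2⟩

/-- With `μ` dominating `ν`, the map `λ ↦ μ - λ` turns lower measures into positive measures and
reverses order, so the supremum is `μ` minus an infimum in the lattice of measures. -/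
theorem exists_isLUB_lowerMeasures {ν : Game Ω} (hν : ν ∈ ACInf Ω) :
    ∃ lo : NA Ω, IsLUB (lowerMeasures ν) lo := by
  obtain ⟨μ, hμ, hμν, hνμ⟩ := hν.2
  let M : Set (Measure Ω) := {m | IsFiniteMeasure m ∧ (∀ x, m {x} = 0) ∧
    ∃ lam ∈ lowerMeasures ν, ∀ S : Coalition Ω, (μ - (lam : Game Ω)) S = m.real (S : Set Ω)}
  have hM : ∀ lam ∈ lowerMeasures ν, ∃ m ∈ M,
      ∀ S : Coalition Ω, (μ - (lam : Game Ω)) S = m.real (S : Set Ω) := fun lam hlam => by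
    obtain ⟨m, h1, h2, h3⟩ := exists_measure_of_mem_NAPos (μ := μ - (lam : Game Ω))
      ⟨sub_mem hμ.1 lam.2, fun S => sub_nonneg.2 ((hlam.le S).trans (hνμ.le S))⟩
    exact ⟨m, ⟨h1, h2, lam, hlam, h3⟩, h3⟩
  -- This makes `M` nonempty, hence its infimum finite.
  have hmem : (⟨-μ, neg_mem hμ.1⟩ : NA Ω) ∈ lowerMeasures ν := hμν
  obtain ⟨m₁, hm₁, -⟩ := hM _ hmem
  have hle₁ : sInf M ≤ m₁ := sInf_le hm₁
  have := hm₁.1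
  have : IsFiniteMeasure (sInf M) := isFiniteMeasure_of_le m₁ hle₁
  let g : Game Ω := ⟨fun S => (sInf M).real (S : Set Ω), measureReal_empty⟩
  have hg : g ∈ NAPos Ω := measure_mem_NAPos (m := sInf M)
    (fun x => le_antisymm ((hle₁ _).trans (hm₁.2.1 x).le) zero_le) (fun _ => rfl)
  refine ⟨⟨μ - g, sub_mem hμ.1 hg.1⟩, fun lam hlam S => ?_, fun κ hκ S => ?_⟩
  · obtain ⟨m, hm, h⟩ := hM lam hlam
    have := hm.1
    have h1 : (sInf M).real (S : Set Ω) ≤ m.real (S : Set Ω) :=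
      ENNReal.toReal_mono (measure_ne_top _ _) (sInf_le hm _)
    rw [← h] at h1
    change (lam : Game Ω) S ≤ μ S - (sInf M).real (S : Set Ω)
    rw [Game.sub_apply] at h1
    linarith
  · obtain ⟨s, -, hs⟩ := sub_mem hμ.1 κ.2
    -- For an upper bound `κ`, the difference `μ - κ` may be signed, so its positive part is
    -- compared with the infimum instead: evaluating on the Hahn set `i` gives `(μ - κ)(i ∩ A) ≤ m(i
    -- ∩ A) ≤ m(A)` for every `m ∈ M`.
    obtain ⟨i, hi, hpos, -, hp, -⟩ := s.toJordanDecomposition_spec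
    have hpS : ∀ S : Set Ω, MeasurableSet S →
        s.toJordanDecomposition.posPart.real S = s (i ∩ S) := fun S hS => by
      rw [hp, SignedMeasure.toMeasureOfZeroLE_real_apply _ _ _ hS]
    have hle : s.toJordanDecomposition.posPart ≤ sInf M := by
      refine le_sInf fun m hm => Measure.le_iff.2 fun A hA => ?_
      obtain ⟨hfin, -, lam, hlam, h⟩ := hm
      have := hfin
      have h1 := hκ hlam ⟨i ∩ A, hi.inter hA⟩
      have h2 := h ⟨i ∩ A, hi.inter hA⟩
      have h3 := hs ⟨i ∩ A, hi.inter hA⟩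
      have h4 : m.real (i ∩ A) ≤ m.real A := measureReal_mono inter_subset_right
      rw [Game.sub_apply] at h2 h3
      rw [← ENNReal.toReal_le_toReal (measure_ne_top _ _) (measure_ne_top _ _)]
      change s.toJordanDecomposition.posPart.real A ≤ m.real A
      rw [hpS A hA]
      change (lam : Game Ω) _ ≤ (κ : Game Ω) _ at h1
      dsimp only at h2 h3
      linarith
    have h1 := hs S
    rw [toJordan_apply s S.2, Game.sub_apply] at h1
    have h2 : s.toJordanDecomposition.posPart.real (S : Set Ω) ≤ (sInf M).real (S : Set Ω) :=
      ENNReal.toReal_mono (measure_ne_top _ _) (hle _)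
    have h3 : 0 ≤ s.toJordanDecomposition.negPart.real (S : Set Ω) := measureReal_nonneg
    change μ S - (sInf M).real (S : Set Ω) ≤ (κ : Game Ω) S
    linarith

theorem neg_mem_lowerMeasures {ν : Game Ω} {lam : NA Ω} :
    -lam ∈ lowerMeasures (-ν) ↔ lam ∈ upperMeasures ν := by
  change ((-ν) - (-(lam : Game Ω))).IsMonotone ↔ ((lam : Game Ω) - ν).IsMonotone
  rw [neg_sub_neg]

theorem exists_isGLB_upperMeasures {ν : Game Ω} (hν : ν ∈ ACInf Ω) :
    ∃ hi : NA Ω, IsGLB (upperMeasures ν) hi := by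
  obtain ⟨lo, h1, h2⟩ := exists_isLUB_lowerMeasures (neg_mem hν)
  refine ⟨-lo, fun lam hlam S => ?_, fun κ hκ S => ?_⟩
  · exact neg_le.1 (h1 (neg_mem_lowerMeasures.2 hlam) S)
  · refine le_neg.1 (h2 (a := -κ) (fun lam hlam S => ?_) S)
    rw [← neg_neg lam, neg_mem_lowerMeasures] at hlam
    exact le_neg.1 (hκ hlam S)

end Bounds

/-! ### An extended integral from an ultrafilter limit. -/

section Construction

variable {Ω : Type*} [MeasurableSpace Ω] [StandardBorelSpace Ω]

/-- Trace sums of a measure are constant, so those of `ν` stay in the compact interval `[-μ S, μ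
S]`. -/
theorem exists_tendsto_traceSum (U : Ultrafilter (Finpartition (⊤ : Coalition Ω)))
    (ν : ACInf Ω) (S : Coalition Ω) :
    ∃ a, Tendsto (traceSum (ν : Game Ω) S) U (𝓝 a) := by
  obtain ⟨μ, hμ, hμν, hνμ⟩ := ν.2.2
  have hb : ∀ D, traceSum (ν : Game Ω) S D ∈ Icc (-μ S) (μ S) := fun D => by
    have h1 := traceSum_mono hμν.le S D
    have h2 := traceSum_mono hνμ.le S D
    rw [traceSum_of_isAdditive (isAdditive_of_mem_NA (neg_mem hμ.1))] at h1
    rw [traceSum_of_isAdditive (isAdditive_of_mem_NA hμ.1)] at h2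
    exact ⟨h1, h2⟩
  obtain ⟨a, -, ha⟩ := isCompact_Icc.ultrafilter_le_nhds' (U.map (traceSum (ν : Game Ω) S))
    (eventually_map.2 (Eventually.of_forall hb))
  exact ⟨a, ha⟩

variable (Ω) in
theorem exists_isExtendedBC : ∃ Φ : ACInf Ω →ₗ[ℝ] NA Ω, IsExtendedBC Φ := by
  classical
  obtain ⟨U, hU⟩ := exists_ultrafilter_finpartition Ω
  choose L hL using exists_tendsto_traceSum U
  have hlow : ∀ (ν : ACInf Ω), ∀ lam ∈ lowerMeasures (ν : Game Ω), ∀ S, (lam : Game Ω) S ≤ L ν S :=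
    fun ν lam hlam S => ge_of_tendsto' (hL ν S) fun D => by
      rw [← traceSum_of_isAdditive (isAdditive_of_mem_NA lam.2) S D]
      exact traceSum_mono hlam.le S D
  have hupp : ∀ (ν : ACInf Ω), ∀ lam ∈ upperMeasures (ν : Game Ω), ∀ S, L ν S ≤ (lam : Game Ω) S :=
    fun ν lam hlam S => le_of_tendsto' (hL ν S) fun D => by
      rw [← traceSum_of_isAdditive (isAdditive_of_mem_NA lam.2) S D]
      exact traceSum_mono hlam.le S D
  have hadd : ∀ ν, IsAdditive (L ν) := fun ν A B hAB => by
    refine tendsto_nhds_unique (hL ν (A ⊔ B)) (((hL ν A).add (hL ν B)).congr' ?_)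
    -- Once `D` refines `P`, no block of `D` meets both `A` and `B`, so the trace sums are already
    -- additive.
    obtain ⟨P, hP⟩ := exists_finpartition_le_or_le_compl A
    filter_upwards [hU P] with D hD
    rw [traceSum, traceSum, traceSum, ← Finset.sum_add_distrib]
    refine Finset.sum_congr rfl fun I hI => ?_
    obtain ⟨J, hJ, hIJ⟩ := hD hI
    rcases hP J hJ with h | h
    · rw [inf_sup_left, (hAB.mono_left (hIJ.trans h)).eq_bot, sup_bot_eq, Game.map_bot, add_zero]
    · rw [inf_sup_left, (le_compl_iff_disjoint_right.1 (hIJ.trans h)).eq_bot, bot_sup_eq,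
        Game.map_bot, zero_add]
  have hbot : ∀ ν, L ν ⊥ = 0 := fun ν => by
    have := hadd ν ⊥ ⊥ disjoint_bot_left
    rw [bot_sup_eq] at this
    linarith
  have hmem : ∀ ν, (⟨L ν, hbot ν⟩ : Game Ω) ∈ NA Ω := fun ν => by
    obtain ⟨μ, hμ, hμν, hνμ⟩ := ν.2.2
    refine mem_NA_of_isAdditive hμ (hadd ν) fun S => abs_le.2 ⟨?_, ?_⟩
    · exact hlow ν ⟨-μ, neg_mem hμ.1⟩ hμν S
    · exact hupp ν ⟨μ, hμ.1⟩ hνμ S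
  let Φ : ACInf Ω →ₗ[ℝ] NA Ω :=
    { toFun := fun ν => ⟨⟨L ν, hbot ν⟩, hmem ν⟩
      map_add' := fun ν ν' => Subtype.ext <| Game.ext fun S => by
        refine tendsto_nhds_unique (hL (ν + ν') S) (((hL ν S).add (hL ν' S)).congr fun D => ?_)
        exact Finset.sum_add_distrib.symm
      map_smul' := fun c ν => Subtype.ext <| Game.ext fun S => by
        refine tendsto_nhds_unique (hL (c • ν) S) (((hL ν S).const_mul c).congr fun D => ?_)
        exact Finset.mul_sum _ _ _ }
  refine ⟨Φ, ⟨NA_le_ACInf, le_rfl, fun ν => ?_⟩, fun ν hν => ?_⟩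
  · obtain ⟨lo, hlo⟩ := exists_isLUB_lowerMeasures ν.2
    obtain ⟨hi, hhi⟩ := exists_isGLB_upperMeasures ν.2
    exact ⟨lo, hi, hlo, hhi, hlo.2 fun lam hlam S => hlow ν lam hlam S,
      hhi.2 fun lam hlam S => hupp ν lam hlam S⟩
  · obtain ⟨m, lam, hlam, h⟩ := hν
    have hm : L ν = m := by
      funext S
      refine tendsto_nhds_unique (hL ν S) (Metric.tendsto_nhds.2 fun ε hε => ?_)
      obtain ⟨δ, hδ, H⟩ := h S ε hε
      -- Eventually `D` refines a partition of mesh below `δ`; its trace on `S` then also has mesh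
      -- below `δ`.
      obtain ⟨P, hP⟩ := exists_finpartition_top_lt hlam hδ
      filter_upwards [hU P] with D hD
      rw [Real.dist_eq, traceSum_eq_restrict]
      refine H _ fun I hI => ?_
      simp only [Finpartition.restrict, Finset.mem_erase, Finset.mem_image] at hI
      obtain ⟨-, J, hJ, rfl⟩ := hI
      obtain ⟨K, hK, hJK⟩ := hD hJ
      exact (NA_isMonotone hlam (inf_le_left.trans hJK)).trans_lt (hP K hK)
    refine ⟨lam, hlam, ?_⟩
    change HasBCIntegral lam ν (L ν)
    rwa [hm]

end Construction

/-! ### Consequences of the Milnor bounds. -/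

section Milnor

variable {Ω : Type*} [MeasurableSpace Ω] [StandardBorelSpace Ω] {W : Submodule ℝ (Game Ω)}
  {ψ : W →ₗ[ℝ] NA Ω}

theorem IsMilnor.le_of_prec (h : IsMilnor W ψ) {lam : Game Ω} (hlam : lam ∈ NA Ω) {ν : W}
    (hν : lam.Prec ν) : lam ≤ (ψ ν : Game Ω) := by
  obtain ⟨lo, hi, hlo, -, hle, -⟩ := h.between ν
  exact (hlo.1 (show (⟨lam, hlam⟩ : NA Ω) ∈ _ from hν)).trans hle

theorem IsMilnor.le_of_prec' (h : IsMilnor W ψ) {lam : Game Ω} (hlam : lam ∈ NA Ω) {ν : W}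
    (hν : (ν : Game Ω).Prec lam) : (ψ ν : Game Ω) ≤ lam := by
  obtain ⟨lo, hi, -, hhi, -, hle⟩ := h.between ν
  exact hle.trans (hhi.1 (show (⟨lam, hlam⟩ : NA Ω) ∈ _ from hν))

/-- The measures `-μ` and `μ` lie below and above `ν`, so `|ψ ν| ≤ μ` setwise; between measures this
is already domination. Hence `ψ` does not increase the norm. -/
theorem IsMilnor.dominates (h : IsMilnor W ψ) {μ : Game Ω} {ν : W} (hν : Dominates μ ν) :
    Dominates μ (ψ ν : Game Ω) :=
  dominates_of_abs_le hν.1 (ψ ν).2 fun S => abs_le.2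
    ⟨h.le_of_prec (neg_mem hν.1.1) hν.2.1 S, h.le_of_prec' hν.1.1 hν.2.2 S⟩

/-- Such a `ν` is itself both a lower and an upper measure of `ν`. -/
theorem IsMilnor.apply_of_mem_NA (h : IsMilnor W ψ) {ν : W} (hν : (ν : Game Ω) ∈ NA Ω) :
    (ψ ν : Game Ω) = ν :=
  le_antisymm (h.le_of_prec' hν (prec_of_le hν hν le_rfl))
    (h.le_of_prec hν (prec_of_le hν hν le_rfl))

/-- A Milnor operator on `AC_∞` as a contraction of `AC_∞`. -/
noncomputable def IsMilnor.toCLM {ψ : ACInf Ω →ₗ[ℝ] NA Ω} (h : IsMilnor (ACInf Ω) ψ) : ACInf Ω →L[ℝ] ACInf Ω :=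
  (Submodule.inclusion NA_le_ACInf ∘ₗ ψ).mkContinuous 1 fun ν => by
    rw [one_mul]
    refine le_of_forall_pos_le_add fun ε hε => ?_
    obtain ⟨μ, hμ, hlt⟩ := exists_lt_lipNorm_add ν.2 hε
    exact (lipNorm_le (h.dominates hμ)).trans hlt.le

end Milnor

/-! ### Automorphisms and symmetry. -/

section Action

variable {Ω : Type*} [MeasurableSpace Ω] [StandardBorelSpace Ω] (θ : Ω ≃ᵐ Ω)

theorem act_mem_NA {μ : Game Ω} (hμ : μ ∈ NA Ω) : act θ μ ∈ NA Ω := by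
  obtain ⟨s, hs, h⟩ := hμ
  rw [isNonatomic_iff] at hs
  -- The action on measures is the pushforward along the inverse automorphism.
  have hmap : ∀ S : Set Ω, MeasurableSet S → s.map θ.symm S = s (θ '' S) := fun S hS => by
    rw [VectorMeasure.map_apply _ θ.symm.measurable hS, θ.image_eq_preimage_symm]
  refine ⟨s.map θ.symm, (isNonatomic_iff _).2 fun x => ?_, fun S => ?_⟩
  · rw [hmap _ (measurableSet_singleton x), image_singleton, hs]
  · rw [hmap _ S.2]
    exact h _

theorem act_mem_NAPos {μ : Game Ω} (hμ : μ ∈ NAPos Ω) : act θ μ ∈ NAPos Ω :=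
  ⟨act_mem_NA θ hμ.1, fun S => hμ.2 ⟨θ '' (S : Set Ω), θ.measurableSet_image.2 S.2⟩⟩

theorem act_mem_NAProb {μ : Game Ω} (hμ : μ ∈ NAProb Ω) : act θ μ ∈ NAProb Ω :=
  ⟨act_mem_NAPos θ hμ.1, (act_top θ μ).trans hμ.2⟩

theorem Dominates.act {μ ν : Game Ω} (h : Dominates μ ν) : Dominates (act θ μ) (act θ ν) :=
  ⟨act_mem_NAPos θ h.1, Game.IsMonotone.act θ h.2.1, Game.IsMonotone.act θ h.2.2⟩

theorem act_mem_ACInf {ν : Game Ω} (hν : ν ∈ ACInf Ω) : act θ ν ∈ ACInf Ω := by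
  obtain ⟨⟨u, v, hu, hv, rfl⟩, μ, hμ⟩ := hν
  exact ⟨⟨act θ u, act θ v, hu.act θ, hv.act θ, rfl⟩, act θ μ, hμ.act θ⟩

/-- The action of an automorphism on `AC_∞`, as a contraction. -/
noncomputable def actCLM : ACInf Ω →L[ℝ] ACInf Ω :=
  LinearMap.mkContinuous
    { toFun := fun ν => ⟨act θ ν, act_mem_ACInf θ ν.2⟩
      map_add' := fun _ _ => rfl
      map_smul' := fun _ _ => rfl } 1 fun ν => by
    rw [one_mul]
    refine le_of_forall_pos_le_add fun ε hε => ?_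
    obtain ⟨μ, hμ, hlt⟩ := exists_lt_lipNorm_add ν.2 hε
    exact (lipNorm_le (hμ.act θ)).trans ((act_top θ μ).trans_le hlt.le)

/-- The action sends `μ^k` to `(ϑ_* μ)^k`, and the preimage of a closed subspace under a continuous
map is closed. -/
theorem actCLM_mem_pNAInf {ν : ACInf Ω} (hν : ν ∈ pNAInf Ω) : actCLM θ ν ∈ pNAInf Ω := by
  refine Submodule.topologicalClosure_minimal (t := (pNAInf Ω).comap (actCLM θ).toLinearMap) _
    (Submodule.span_le.2 ?_)
    ((Submodule.isClosed_topologicalClosure _).preimage (actCLM θ).continuous) hν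
  rintro ν ⟨μ, hμ, k, hk, h⟩
  refine Submodule.le_topologicalClosure _ (Submodule.subset_span ?_)
  exact ⟨act θ μ, act_mem_NAProb θ hμ, k, hk, fun S => h _⟩

theorem isSymmetric_pNAInf : IsSymmetric ((pNAInf Ω).map (ACInf Ω).subtype) := by
  rintro θ _ ⟨ν, hν, rfl⟩
  exact ⟨actCLM θ ν, actCLM_mem_pNAInf θ hν, rfl⟩

/-- Powers lie in `Q`, so uniqueness of the integral leaves no freedom in the choice of `Φ`. -/
theorem IsExtendedBC.apply_pow {Φ : ACInf Ω →ₗ[ℝ] NA Ω} (h : IsExtendedBC Φ) {μ : Game Ω}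
    (hμ : μ ∈ NAProb Ω) {k : ℕ} (hk : 1 ≤ k) {ν : ACInf Ω} (hν : ∀ S, (ν : Game Ω) S = μ S ^ k)
    (S : Coalition Ω) : (Φ ν : Game Ω) S = if k = 1 then μ S else 0 :=
  congrFun ((h.extends_BC ν ⟨_, isBCIntegral_pow hμ hk hν⟩).unique (isBCIntegral_pow hμ hk hν)) S

theorem IsExtendedBC.act_apply {Φ : ACInf Ω →ₗ[ℝ] NA Ω} (h : IsExtendedBC Φ) {ν : ACInf Ω}
    (hν : ν ∈ pNAInf Ω) : act θ (Φ ν : Game Ω) = (Φ (actCLM θ ν) : Game Ω) := by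
  -- Viewed as maps into `AC_∞`, both sides are continuous, so their equality set is closed and it
  -- suffices to test powers.
  let A : ACInf Ω →L[ℝ] ACInf Ω := (actCLM θ).comp h.isMilnor.toCLM
  let B : ACInf Ω →L[ℝ] ACInf Ω := h.isMilnor.toCLM.comp (actCLM θ)
  suffices pNAInf Ω ≤ LinearMap.eqLocus A.toLinearMap B.toLinearMap from
    congrArg Subtype.val (this hν)
  refine Submodule.topologicalClosure_minimal _ (Submodule.span_le.2 ?_)
    (isClosed_eq A.continuous B.continuous)
  rintro ν ⟨μ, hμ, k, hk, hν⟩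
  refine Subtype.ext (Game.ext fun S => ?_)
  exact (h.apply_pow hμ hk hν _).trans
    (h.apply_pow (act_mem_NAProb θ hμ) hk (ν := actCLM θ ν) (fun S => hν _) S).symm

end Action

end NonatomicGames

open NonatomicGames in
theorem corollary4p2 {Ω : Type*} [MeasurableSpace Ω] [StandardBorelSpace Ω] :
    pNAInf Ω ≤ Y Ω ∧
    (∃ Φ : ACInf Ω →ₗ[ℝ] NA Ω, IsExtendedBC Φ) ∧
    ∀ Φ : ACInf Ω →ₗ[ℝ] NA Ω, IsExtendedBC Φ →
      IsSemivalue ((pNAInf Ω).map (ACInf Ω).subtype)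
        (Φ ∘ₗ Submodule.inclusion (Submodule.map_subtype_le (ACInf Ω) (pNAInf Ω))) ∧
      Continuous (fun ν : pNAInf Ω => Submodule.inclusion NA_le_ACInf (Φ ν)) := by
  refine ⟨pNAInf_le_Y Ω, exists_isExtendedBC Ω, fun Φ hΦ => ⟨⟨?_, isSymmetric_pNAInf, ?_, ?_, ?_⟩,
    hΦ.isMilnor.toCLM.continuous.comp continuous_subtype_val⟩⟩
  · exact (Submodule.map_subtype_le _ _).trans fun ν hν => hν.1
  · rintro θ ⟨_, ν, hν, rfl⟩
    exact hΦ.act_apply θ hν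
  · intro ν hν
    -- Monotonicity of `ν` says `0 ≼ ν`, and `0` is a measure.
    refine hΦ.isMilnor.le_of_prec (zero_mem _) ?_
    change (_ - 0 : Game Ω).IsMonotone
    rw [sub_zero]
    exact hν
  · intro ν hν
    exact hΦ.isMilnor.apply_of_mem_NA hν
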